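/- **Setting.** Let $E$ be a finite set and, for $i\in E$, let $F^i:\mathbb R^d\to\mathbb R^d$ be a smooth bounded vector field with flow $\Phi^i=(\Phi^i_t)$. Let $M\subset\mathbb R^d$ be a compact set with $\Phi^i_t(M)\subset M$ for all $t\ge 0$ and $i\in E$. For $x\in M$ let $(\lambda(x,i,j))_{i,j\in E}$ be an irreducible matrix with $\lambda(x,i,j)\ge 0$ for $i\ne j$ and $\lambda(x,i,i)=0$, where each $x\mapsto\lambda(x,i,j)$ is continuous on $M$ (irreducible: any state can be reached from any other one through transitions of positive rate). Fix $\lambda>0$ such that $\sum_{j\neq i}\lambda(x,i,j)<\lambda$ for all $x\in M$, $i\in E$, and put $Q(x,i,j)=\lambda(x,i,j)/\lambda$ for $i\ne j$ and $Q(x,i,i)=1-\sum_{j\ne i}Q(x,i,j)$. Under $\mathbb P_{x,i}$, let $(U_n)_{n\ge1}$ be the interarrival times and $T_n=U_1+\dots+U_n$ ($T_0=0$) the jump times of a Poisson process of intensity $\lambda$, and let $\tilde Z_n=(\tilde X_n,\tilde Y_n)\in M\times E$ be the chain with $\tilde Z_0=(x,i)$ that is defined recursively as follows: $U_{n+1}$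 is exponential with parameter $\lambda$ and independent of $(U_k)_{k\le n}$, $(\tilde Z_k)_{k\le n}$; $\tilde X_{n+1}=\Phi^{\tilde Y_n}_{U_{n+1}}(\tilde X_n)$; and, given $U_{n+1}$ and the past, $\tilde Y_{n+1}=j$ with probability $Q(\tilde X_{n+1},\tilde Y_n,j)$. The continuous time process is $Z_t=(\Phi^{\tilde Y_n}_{t-T_n}(\tilde X_n),\tilde Y_n)$ for $T_n\le t<T_{n+1}$. For $x\in M$ let $\gamma^+(x)=\{\Phi^{i_{n-1}}_{u_n}\circ\dots\circ\Phi^{i_0}_{u_1}(x): n\ge1,\ i_0,\dots,i_{n-1}\in E,\ u_1,\dots,u_n\ge0\}$, and let $\Gamma=\{y\in M:\ y\in\overline{\gamma^+(x)}\text{ for all }x\in M\}$ be the accessible set. **Proposition (returns near $\Gamma$).** Let $p\in\Gamma$ and let $\mathcal U$ be a neighbourhood of $p$ in $M$. 1. (Discrete time.) There exist $m\in\mathbb N$ and $\delta>0$ such that for all $i,j\in E$ and $x\in M$, $$\mathbb P_{x,i}\big(\tilde Z_m\in\mathcal U\times\{j\}\big)\ge\delta.$$ In particular, $\mathbb P_{x,i}\big(\exists\,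 l\in\mathbb N:\ \tilde Z_l\in\mathcal U\times\{j\}\big)=1$ for all $x\in M$ and $i,j\in E$. 2. (Continuous time.) There exist $N\in\mathbb N$, a finite covering $\mathcal O^1,\dots,\mathcal O^N$ of $M$ by (relatively) open sets, times $t_1,\dots,t_N>0$ and $\delta>0$ such that for all $i,j\in E$, all $k\in\{1,\dots,N\}$ and all $x\in\mathcal O^k$, $$\mathbb P_{x,i}\big(Z_{t_k}\in\mathcal U\times\{j\}\big)\ge\delta.$$ -/

import Mathlib

open MeasureTheory ProbabilityTheory Set Topology
open scoped NNReal ENNReal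

noncomputable section

namespace SwitchedFlow

/-- The space `ℝ^d` with its Euclidean norm. -/
abbrev Vec (d : ℕ) := EuclideanSpace ℝ (Fin d)

/-- `γ : ℝ → ℝ^d` is a global solution of the Cauchy problem `γ' = F(γ)`, `γ(0) = x`. -/
def IsSolution {d : ℕ} (F : Vec d → Vec d) (x : Vec d) (γ : ℝ → Vec d) : Prop :=
  γ 0 = x ∧ ∀ t, HasDerivAt γ (F (γ t)) t

open Classical in
/-- The flow `Φ_t(x)` of the vector field `F`. For smooth bounded `F` a global solution exists
(`isSolution_flow`) and is unique (`flow_unique`), so that the `else` branch is never used. -/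
def flow {d : ℕ} (F : Vec d → Vec d) (t : ℝ) (x : Vec d) : Vec d :=
  if h : ∃ γ, IsSolution F x γ then h.choose t else x

section FlowLemmas

theorem dist_le_of_solution {d : ℕ} {F : Vec d → Vec d} {C r : ℝ}
    (hC : ∀ x, ‖F x‖ ≤ C) {γ : ℝ → Vec d} (hr : 0 < r)
    (hγ : ∀ t ∈ Ioo (-r) r, HasDerivAt γ (F (γ t)) t) {t : ℝ} (ht : t ∈ Ioo (-r) r) :
    dist (γ t) (γ 0) ≤ C * |t| := by
  have h := Convex.norm_image_sub_le_of_norm_hasDerivWithin_le (f := γ)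
    (f' := fun s => F (γ s)) (s := Ioo (-r) r) (x := 0) (y := t) (C := C)
    (fun s hs => (hγ s hs).hasDerivWithinAt) (fun s _ => hC _) (convex_Ioo _ _)
    ⟨by linarith, hr⟩ ht
  simpa [dist_eq_norm] using h

theorem eqOn_of_solution {d : ℕ} {F : Vec d → Vec d} (hF : ContDiff ℝ (⊤ : ℕ∞) F) {C r : ℝ}
    (hC : ∀ x, ‖F x‖ ≤ C) {α β : ℝ → Vec d} (hr : 0 < r)
    (hα : ∀ t ∈ Ioo (-r) r, HasDerivAt α (F (α t)) t)
    (hβ : ∀ t ∈ Ioo (-r) r, HasDerivAt β (F (β t)) t) (h0 : α 0 = β 0) :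
    EqOn α β (Ioo (-r) r) := by
  have hC0 : 0 ≤ C := (norm_nonneg _).trans (hC 0)
  obtain ⟨K, hK⟩ := (hF.contDiffOn (s := Metric.closedBall (α 0) (C * r))).exists_lipschitzOnWith
    (by simp) (convex_closedBall _ _) (isCompact_closedBall _ _)
  have key : ∀ {γ : ℝ → Vec d}, (∀ t ∈ Ioo (-r) r, HasDerivAt γ (F (γ t)) t) → γ 0 = α 0 →
      ∀ t ∈ Ioo (-r) r, γ t ∈ Metric.closedBall (α 0) (C * r) := by
    intro γ hγ h t ht
    rw [Metric.mem_closedBall, ← h]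
    refine (dist_le_of_solution hC hr hγ ht).trans ?_
    have : |t| ≤ r := (abs_lt.mpr ⟨ht.1, ht.2⟩).le
    gcongr
  exact ODE_solution_unique_of_mem_Ioo (v := fun _ => F)
    (s := fun _ => Metric.closedBall (α 0) (C * r)) (K := K) (t₀ := 0)
    (fun _ _ => hK) ⟨by linarith, hr⟩
    (fun t ht => ⟨hα t ht, key hα rfl t ht⟩) (fun t ht => ⟨hβ t ht, key hβ h0.symm t ht⟩) h0

theorem exists_solution {d : ℕ} {F : Vec d → Vec d} (hF : ContDiff ℝ (⊤ : ℕ∞) F) {C : ℝ}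
    (hC : ∀ x, ‖F x‖ ≤ C) (x : Vec d) : ∃ γ, IsSolution F x γ := by
  have hC0 : 0 ≤ C := (norm_nonneg _).trans (hC 0)
  have hloc : ∀ n : ℕ, ∃ α : ℝ → Vec d, α 0 = x ∧
      ∀ t ∈ Ioo (-((n : ℝ) + 1)) ((n : ℝ) + 1), HasDerivAt α (F (α t)) t := by
    intro n
    have hn : (0 : ℝ) < (n : ℝ) + 1 := by positivity
    obtain ⟨K, hK⟩ := (hF.contDiffOn
      (s := Metric.closedBall x (C * ((n : ℝ) + 1)))).exists_lipschitzOnWith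
      (by simp) (convex_closedBall _ _) (isCompact_closedBall _ _)
    have hP : IsPicardLindelof (fun _ : ℝ => F) (tmin := -((n : ℝ) + 1)) (tmax := (n : ℝ) + 1)
        ⟨0, by constructor <;> linarith⟩ x ⟨C * ((n : ℝ) + 1), by positivity⟩ 0 ⟨C, hC0⟩ K :=
      IsPicardLindelof.of_time_independent (fun y _ => hC y) hK (by
        simp only [sub_zero, zero_sub, neg_neg, max_self, NNReal.coe_zero]
        exact le_rfl)
    obtain ⟨α, h0, hα⟩ := hP.exists_eq_forall_mem_Icc_hasDerivWithinAt₀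
    exact ⟨α, h0, fun t ht => (hα t (Ioo_subset_Icc_self ht)).hasDerivAt
      (Icc_mem_nhds ht.1 ht.2)⟩
  choose α h0 hα using hloc
  have hagree : ∀ (m n : ℕ) (t : ℝ), |t| < (m : ℝ) + 1 → |t| < (n : ℝ) + 1 →
      α m t = α n t := by
    intro m n t hm hn
    have hr : (0 : ℝ) < min ((m : ℝ) + 1) ((n : ℝ) + 1) := by positivity
    refine eqOn_of_solution hF hC hr (fun s hs => hα m s ?_) (fun s hs => hα n s ?_)
      ((h0 m).trans (h0 n).symm) (abs_lt.mp (lt_min hm hn))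
    · have := min_le_left ((m : ℝ) + 1) ((n : ℝ) + 1)
      exact ⟨by linarith [hs.1], by linarith [hs.2]⟩
    · have := min_le_right ((m : ℝ) + 1) ((n : ℝ) + 1)
      exact ⟨by linarith [hs.1], by linarith [hs.2]⟩
  refine ⟨fun t => α ⌈|t|⌉₊ t, by simpa using h0 _, fun t => ?_⟩
  have hlt : ∀ s : ℝ, |s| < (⌈|s|⌉₊ : ℝ) + 1 := fun s => by
    have := Nat.le_ceil |s|
    linarith
  have hd := hα (⌈|t|⌉₊) t (abs_lt.mp (hlt t))
  refine hd.congr_of_eventuallyEq ?_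
  have hopen : ∀ᶠ s in 𝓝 t, |s| < (⌈|t|⌉₊ : ℝ) + 1 :=
    (continuous_abs.tendsto t).eventually (gt_mem_nhds (hlt t))
  filter_upwards [hopen] with s hs
  exact hagree _ _ s (hlt s) hs

theorem isSolution_flow {d : ℕ} {F : Vec d → Vec d} (hF : ContDiff ℝ (⊤ : ℕ∞) F)
    (hC : ∃ C, ∀ x, ‖F x‖ ≤ C) (x : Vec d) : IsSolution F x (fun t => flow F t x) := by
  obtain ⟨C, hC⟩ := hC
  have h := exists_solution hF hC x
  have e : (fun t => flow F t x) = h.choose := by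
    funext t
    simp only [flow, dif_pos h]
  rw [e]
  exact h.choose_spec

theorem flow_unique {d : ℕ} {F : Vec d → Vec d} (hF : ContDiff ℝ (⊤ : ℕ∞) F)
    (hC : ∃ C, ∀ x, ‖F x‖ ≤ C) {x : Vec d} {γ : ℝ → Vec d} (hγ : IsSolution F x γ) (t : ℝ) :
    γ t = flow F t x := by
  have h := isSolution_flow hF hC x
  obtain ⟨C, hC⟩ := hC
  have ht : t ∈ Ioo (-(|t| + 1)) (|t| + 1) :=
    ⟨by linarith [neg_abs_le t], by linarith [le_abs_self t]⟩
  exact eqOn_of_solution hF hC (by positivity) (fun s _ => hγ.2 s) (fun s _ => h.2 s)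
    (hγ.1.trans h.1.symm) ht

theorem continuous_flow {d : ℕ} {F : Vec d → Vec d} (hF : ContDiff ℝ (⊤ : ℕ∞) F)
    (hC : ∃ C, ∀ x, ‖F x‖ ≤ C) : Continuous fun q : ℝ≥0 × Vec d => flow F q.1 q.2 := by
  have hsol := isSolution_flow hF hC
  obtain ⟨C, hC⟩ := hC
  have hC0 : 0 ≤ C := (norm_nonneg _).trans (hC 0)
  have hball : ∀ (x : Vec d) (t : ℝ), 0 ≤ t → dist (flow F t x) x ≤ C * t := by
    intro x t ht
    have h := dist_le_of_solution hC (r := |t| + 1) (by positivity)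
      (fun s _ => (hsol x).2 s)
      (t := t) ⟨by linarith [neg_abs_le t], by linarith [le_abs_self t]⟩
    have h0 : flow F 0 x = x := (hsol x).1
    rwa [h0, abs_of_nonneg ht] at h
  rw [continuous_iff_continuousAt]
  rintro ⟨t₀, x₀⟩
  obtain ⟨K, hK⟩ := (hF.contDiffOn
    (s := Metric.closedBall x₀ (1 + C * ((t₀ : ℝ) + 1)))).exists_lipschitzOnWith
    (by simp) (convex_closedBall _ _) (isCompact_closedBall _ _)
  have hmem : ∀ x ∈ Metric.closedBall x₀ 1, ∀ t ∈ Icc (0 : ℝ) ((t₀ : ℝ) + 1),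
      flow F t x ∈ Metric.closedBall x₀ (1 + C * ((t₀ : ℝ) + 1)) := by
    intro x hx t ht
    have h1 := hball x t ht.1
    have h2 : C * t ≤ C * ((t₀ : ℝ) + 1) := mul_le_mul_of_nonneg_left ht.2 hC0
    have h3 := dist_triangle (flow F t x) x x₀
    rw [Metric.mem_closedBall] at hx ⊢
    linarith
  have hcont : ∀ x, Continuous fun t => flow F t x := fun x =>
    continuous_iff_continuousAt.mpr fun t => ((hsol x).2 t).continuousAt
  have hlip : ∀ x ∈ Metric.closedBall x₀ 1, ∀ t ∈ Icc (0 : ℝ) ((t₀ : ℝ) + 1),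
      dist (flow F t x) (flow F t x₀) ≤ dist x x₀ * Real.exp (K * ((t₀ : ℝ) + 1)) := by
    intro x hx t ht
    have h := dist_le_of_trajectories_ODE_of_mem (v := fun _ => F) (K := K) (a := 0)
      (b := (t₀ : ℝ) + 1) (s := fun _ => Metric.closedBall x₀ (1 + C * ((t₀ : ℝ) + 1)))
      (f := fun t => flow F t x) (g := fun t => flow F t x₀) (δ := dist x x₀)
      (fun _ _ => hK) (hcont x).continuousOn (fun s _ => ((hsol x).2 s).hasDerivWithinAt)
      (fun s hs => hmem x hx s (Ico_subset_Icc_self hs))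
      (hcont x₀).continuousOn (fun s _ => ((hsol x₀).2 s).hasDerivWithinAt)
      (fun s hs => hmem x₀ (Metric.mem_closedBall_self zero_le_one) s (Ico_subset_Icc_self hs))
      (by
        have h0 : flow F 0 x = x := (hsol x).1
        have h0' : flow F 0 x₀ = x₀ := (hsol x₀).1
        simp only [h0, h0', le_refl]) t ht
    refine h.trans ?_
    gcongr
    linarith [ht.2]
  rw [ContinuousAt, tendsto_iff_dist_tendsto_zero]
  have hb : Filter.Tendsto (fun q : ℝ≥0 × Vec d =>
      dist q.2 x₀ * Real.exp (K * ((t₀ : ℝ) + 1)) + dist (flow F q.1 x₀) (flow F t₀ x₀))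
      (𝓝 (t₀, x₀)) (𝓝 0) := by
    have hc : Continuous (fun q : ℝ≥0 × Vec d =>
        dist q.2 x₀ * Real.exp (K * ((t₀ : ℝ) + 1)) + dist (flow F q.1 x₀) (flow F t₀ x₀)) := by
      have h1 : Continuous (fun q : ℝ≥0 × Vec d => flow F (q.1 : ℝ) x₀) :=
        (hcont x₀).comp (by fun_prop)
      fun_prop
    simpa using hc.tendsto (t₀, x₀)
  refine squeeze_zero' (Filter.Eventually.of_forall fun _ => dist_nonneg) ?_ hb
  have e1 : ∀ᶠ q : ℝ≥0 × Vec d in 𝓝 (t₀, x₀), q.1 < t₀ + 1 :=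
    (continuous_fst.tendsto (t₀, x₀)).eventually (gt_mem_nhds (by simp))
  have e2 : ∀ᶠ q : ℝ≥0 × Vec d in 𝓝 (t₀, x₀), q.2 ∈ Metric.closedBall x₀ 1 :=
    (continuous_snd.tendsto (t₀, x₀)).eventually (Metric.closedBall_mem_nhds _ one_pos)
  filter_upwards [e1, e2] with q h1 h2
  have h1' : (q.1 : ℝ) ≤ (t₀ : ℝ) + 1 := by exact_mod_cast h1.le
  exact (dist_triangle _ (flow F q.1 x₀) _).trans
    (by gcongr; exact hlip q.2 h2 q.1 ⟨q.1.2, h1'⟩)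

end FlowLemmas

/-- The data of the switched process on `M × E`: smooth bounded vector fields `F i` on `ℝ^d`,
a compact set `M` positively invariant under all their flows, jump rates `rate x i j`,
and a dominating rate `lam` for the homogeneous Poisson clock. -/
structure System (d : ℕ) (E : Type*) [Fintype E] where
  F : E → Vec d → Vec d
  smooth : ∀ i, ContDiff ℝ (⊤ : ℕ∞) (F i)
  bounded : ∃ C, ∀ i x, ‖F i x‖ ≤ C
  M : Set (Vec d)
  isCompact : IsCompact M
  invariant : ∀ i, ∀ t : ℝ, 0 ≤ t → ∀ x ∈ M, flow (F i) t x ∈ M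
  rate : M → E → E → ℝ
  rate_continuous : ∀ i j, Continuous fun x => rate x i j
  rate_nonneg : ∀ x i j, i ≠ j → 0 ≤ rate x i j
  rate_diag : ∀ x i, rate x i i = 0
  /-- Each matrix `rate x` is irreducible: any state can be reached from any other one through
  finitely many transitions of positive rate. -/
  irreducible : ∀ x i j, Relation.ReflTransGen (fun a b => 0 < rate x a b) i j
  lam : ℝ
  lam_pos : 0 < lam
  sum_rate_lt : ∀ x i, ∑ j, rate x i j < lam

namespace System

variable {d : ℕ} {E : Type*} [Fintype E] (S : System d E)

/-- The flow `Φ^i_t`, `t ≥ 0`, on the positively invariant set `M`. -/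
def Phi (i : E) (t : ℝ≥0) (x : S.M) : S.M :=
  ⟨flow (S.F i) t x, S.invariant i t t.2 x x.2⟩

theorem continuous_Phi (i : E) : Continuous fun q : ℝ≥0 × S.M => S.Phi i q.1 q.2 := by
  refine Continuous.subtype_mk ?_ _
  have hC : ∃ C, ∀ x, ‖S.F i x‖ ≤ C := S.bounded.imp fun _ h => h i
  exact (continuous_flow (S.smooth i) hC).comp
    (f := fun q : ℝ≥0 × S.M => ((q.1, (q.2 : Vec d)) : ℝ≥0 × Vec d)) (by fun_prop)

open Classical in
/-- The transition matrix `Q(x)`: `Q(x,i,j) = rate(x,i,j)/lam` for `i ≠ j`, and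
`Q(x,i,i) = 1 - ∑_{j ≠ i} Q(x,i,j)`. -/
def Q (x : S.M) (i j : E) : ℝ :=
  if i = j then 1 - ∑ k ∈ Finset.univ.erase i, S.rate x i k / S.lam else S.rate x i j / S.lam

theorem Q_nonneg (x : S.M) (i j : E) : 0 ≤ S.Q x i j := by
  classical
  have hl := S.lam_pos
  unfold Q
  split_ifs with h
  · rw [← Finset.sum_div, sub_nonneg, div_le_one hl,
      Finset.sum_erase _ (S.rate_diag x i)]
    exact (S.sum_rate_lt x i).le
  · exact div_nonneg (S.rate_nonneg x i j h) hl.le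

theorem sum_Q (x : S.M) (i : E) : ∑ j, S.Q x i j = 1 := by
  classical
  rw [← Finset.add_sum_erase _ _ (Finset.mem_univ i)]
  have h : ∑ j ∈ Finset.univ.erase i, S.Q x i j =
      ∑ j ∈ Finset.univ.erase i, S.rate x i j / S.lam :=
    Finset.sum_congr rfl fun j hj => by
      unfold Q
      rw [if_neg (Finset.ne_of_mem_erase hj).symm]
  rw [h]
  unfold Q
  simp

theorem continuous_Q (i j : E) : Continuous fun x => S.Q x i j := by
  classical
  have := S.rate_continuous
  unfold Q
  split_ifs <;> fun_prop

/-- The composite flow: `x_0 = x` and `x_{k+1} = Φ^{i_k}_{u_{k+1}}(x_k)`. -/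
def compositeFlow (i : ℕ → E) (u : ℕ → ℝ≥0) (x : S.M) : ℕ → S.M
  | 0 => x
  | k + 1 => S.Phi (i k) (u (k + 1)) (compositeFlow i u x k)

/-- The positive orbit `γ⁺(x)`: all points that can be reached from `x` by following `n ≥ 1`
of the flows successively (only `i_0, …, i_{n-1}` and `u_1, …, u_n` matter). -/
def positiveOrbit (x : S.M) : Set S.M :=
  {y | ∃ n : ℕ, 1 ≤ n ∧ ∃ (i : ℕ → E) (u : ℕ → ℝ≥0), y = S.compositeFlow i u x n}

/-- The accessible set `Γ = ⋂_{x ∈ M} closure (γ⁺(x))`, as a subset of `M`. -/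
def accessibleSet : Set S.M := ⋂ x : S.M, closure (S.positiveOrbit x)

/-- The exponential law of parameter `lam`, as a probability measure on `[0,∞)`. -/
def waitingLaw : Measure ℝ≥0 := (expMeasure S.lam).map Real.toNNReal

instance : IsProbabilityMeasure S.waitingLaw :=
  have := isProbabilityMeasure_expMeasure S.lam_pos
  Measure.isProbabilityMeasure_map (by fun_prop)

/-- The canonical space of the construction: a point `ω` lists the pairs
`ω n = (U_n, Z̃_n)` of the interarrival times and of the states of the embedded chain
(the entry `U_0` is set to `0` and plays no role). -/
abbrev Path := ℕ → ℝ≥0 × (S.M × E)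

/-- The embedded chain `Z̃_n = (X̃_n, Ỹ_n)`. -/
def chain (n : ℕ) (ω : S.Path) : S.M × E := (ω n).2

/-- The jump times `T_n = U_1 + ⋯ + U_n` of the Poisson clock. -/
def jumpTime (n : ℕ) (ω : S.Path) : ℝ≥0 := ∑ k ∈ Finset.range n, (ω (k + 1)).1

/-- The number `N_t` of jump times in `(0,t]`, i.e. the largest `n` such that `T_n ≤ t`
(the junk value `0` is used on the null event that there is no largest one). -/
def count (t : ℝ≥0) (ω : S.Path) : ℕ := sSup {n | S.jumpTime n ω ≤ t}

/-- The continuous time process `Z_t = (Φ^{Ỹ_n}(t - T_n, X̃_n), Ỹ_n)` for `T_n ≤ t < T_{n+1}`. -/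
def process (t : ℝ≥0) (ω : S.Path) : S.M × E :=
  let n := S.count t ω
  (S.Phi (S.chain n ω).2 (t - S.jumpTime n ω) (S.chain n ω).1, (S.chain n ω).2)

theorem process_eq {t : ℝ≥0} {ω : S.Path} {n : ℕ} (h₁ : S.jumpTime n ω ≤ t)
    (h₂ : t < S.jumpTime (n + 1) ω) :
    S.process t ω =
      (S.Phi (S.chain n ω).2 (t - S.jumpTime n ω) (S.chain n ω).1, (S.chain n ω).2) := by
  have hmono : Monotone fun n => S.jumpTime n ω := fun a b hab =>
    Finset.sum_le_sum_of_subset (Finset.range_mono hab)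
  have hcount : S.count t ω = n := by
    refine IsGreatest.csSup_eq ⟨h₁, fun m hm => ?_⟩
    by_contra! hlt
    exact absurd ((hmono (Nat.succ_le_of_lt hlt)).trans hm) (not_le.mpr h₂)
  simp only [process, hcount]

variable [MeasurableSpace E] [MeasurableSingletonClass E]

/-- Given the current state `(x,i)` and the waiting time `u`, the law of `(u, (x', j))`:
`x' = Φ^i_u(x)`, and `j` is drawn from `Q(x',i,·)`. -/
def jumpMeasure (q : (S.M × E) × ℝ≥0) : Measure (ℝ≥0 × (S.M × E)) :=
  ∑ j, ENNReal.ofReal (S.Q (S.Phi q.1.2 q.2 q.1.1) q.1.2 j) •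
    Measure.dirac (q.2, (S.Phi q.1.2 q.2 q.1.1, j))

theorem measurable_jumpMeasure : Measurable S.jumpMeasure := by
  have hE : Measurable (fun q : (S.M × E) × ℝ≥0 => S.Phi q.1.2 q.2 q.1.1) := by
    have h : Measurable (fun r : E × (ℝ≥0 × S.M) => S.Phi r.1 r.2.1 r.2.2) :=
      measurable_from_prod_countable_right fun i => (S.continuous_Phi i).measurable
    exact h.comp (g := fun r : E × (ℝ≥0 × S.M) => S.Phi r.1 r.2.1 r.2.2)
      (f := fun q : (S.M × E) × ℝ≥0 => (q.1.2, (q.2, q.1.1))) (by fun_prop)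
  have hQ : ∀ j, Measurable (fun q : (S.M × E) × ℝ≥0 =>
      S.Q (S.Phi q.1.2 q.2 q.1.1) q.1.2 j) := fun j => by
    have h : Measurable (fun r : E × S.M => S.Q r.2 r.1 j) :=
      measurable_from_prod_countable_right fun i => (S.continuous_Q i j).measurable
    exact h.comp (g := fun r : E × S.M => S.Q r.2 r.1 j)
      (f := fun q : (S.M × E) × ℝ≥0 => (q.1.2, S.Phi q.1.2 q.2 q.1.1)) (by fun_prop)
  refine Measure.measurable_of_measurable_coe _ fun A hA => ?_
  simp only [jumpMeasure, Measure.finsetSum_apply, Measure.smul_apply, smul_eq_mul]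
  refine Finset.measurable_sum _ fun j _ => Measurable.mul ?_ ?_
  · exact (hQ j).ennreal_ofReal
  · simp only [Measure.dirac_apply' _ hA]
    exact (measurable_one.indicator hA).comp
      (f := fun q : (S.M × E) × ℝ≥0 => (q.2, (S.Phi q.1.2 q.2 q.1.1, j))) (by fun_prop)

/-- `jumpMeasure` as a Markov kernel. -/
def jumpKernel : Kernel ((S.M × E) × ℝ≥0) (ℝ≥0 × (S.M × E)) :=
  ⟨S.jumpMeasure, S.measurable_jumpMeasure⟩

instance : IsMarkovKernel S.jumpKernel := ⟨fun q => ⟨by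
  change S.jumpMeasure q univ = 1
  simp only [jumpMeasure, Measure.finsetSum_apply, Measure.smul_apply, smul_eq_mul,
    measure_univ, mul_one]
  rw [← ENNReal.ofReal_sum_of_nonneg fun j _ => S.Q_nonneg _ _ _, S.sum_Q, ENNReal.ofReal_one]⟩⟩

/-- One step of the embedded chain, together with its waiting time: from `(x,i)`, draw `U` from
the exponential law of parameter `lam`, set `X' = Φ^i_U(x)`, draw `Y'` from `Q(X',i,·)`;
the kernel gives the law of `(U, (X', Y'))`. -/
def stepKernel : Kernel (S.M × E) (ℝ≥0 × (S.M × E)) :=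
  S.jumpKernel ∘ₖ (Kernel.id ×ₖ Kernel.const _ S.waitingLaw)

instance : IsMarkovKernel S.stepKernel := by
  unfold stepKernel
  infer_instance

theorem stepKernel_apply (z : S.M × E) {A : Set (ℝ≥0 × (S.M × E))} (hA : MeasurableSet A) :
    S.stepKernel z A = ∫⁻ u, ∑ j, ENNReal.ofReal (S.Q (S.Phi z.2 u z.1) z.2 j) *
      A.indicator 1 (u, (S.Phi z.2 u z.1, j)) ∂S.waitingLaw := by
  rw [stepKernel, Kernel.comp_apply' _ _ _ hA, Kernel.prod_apply, Kernel.id_apply,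
    Kernel.const_apply, Measure.dirac_prod, lintegral_map (Kernel.measurable_coe _ hA)
    (by fun_prop)]
  refine lintegral_congr fun u => ?_
  change S.jumpMeasure (z, u) A = _
  simp only [jumpMeasure, Measure.finsetSum_apply, Measure.smul_apply, smul_eq_mul,
    Measure.dirac_apply' _ hA]

/-- The step kernel as a function of the history up to time `n`. -/
def historyKernel (n : ℕ) :
    Kernel ((k : Finset.Iic n) → ℝ≥0 × (S.M × E)) (ℝ≥0 × (S.M × E)) :=
  S.stepKernel.comap (fun h => (h ⟨n, Finset.mem_Iic.mpr le_rfl⟩).2) (by fun_prop)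

instance (n : ℕ) : IsMarkovKernel (S.historyKernel n) := by
  unfold historyKernel
  infer_instance

/-- The probability `P_{x,i}` on the canonical space: the Markov chain with transitions
`stepKernel`, started at `Z̃_0 = (x,i)`. -/
def prob (x : S.M) (i : E) : Measure S.Path :=
  Kernel.trajMeasure (X := fun _ => ℝ≥0 × (S.M × E))
    (Measure.dirac ((0 : ℝ≥0), (x, i))) S.historyKernel

instance (x : S.M) (i : E) : IsProbabilityMeasure (S.prob x i) := by
  unfold prob
  infer_instance

end System

end SwitchedFlow

end

/-! ### Semicontinuity of integrals and full support of the exponential law -/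

namespace SwitchedFlow

/-! The mean of `h (T_n, Z̃_n)` from `(x,i)` is `timedStep^[n] h (0, (x, i))`. For `h` the indicator
of a set open in each mode, `h` is lower semicontinuous, and continuity of the flows and of `Q`
together with Fatou's lemma preserves this under iteration. The waiting law charges every nonempty
open set, so a mean is positive as soon as one admissible choice of waiting times and modes leads to
a point where `h` is positive. Accessibility of `p` provides a composite flow into the target, and
irreducibility allows any change of mode by jumps of zero duration
(`exists_iterate_pos_of_compositeFlow`).

In discrete time, `Q x i i > 0` allows idle jumps, so positivity persists as `n` grows; compactness
of `M` gives one `m` for all starting points, and semicontinuity a positive minimum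
(`exists_forall_le_iterate`). The Markov property turns this into repeated trials, hence almost sure
hitting.

In continuous time, `h` is the indicator of `flowInto t V j`, and a waiting time longer than `t`
forbids any further jump before `t` (`mul_le_prob_process`). The time `t` depends on the starting
point but works locally, whence the finite covering. -/

theorem lowerSemicontinuous_ennreal_mul {X : Type*} [TopologicalSpace X] {f g : X → ℝ≥0∞}
    (hf : LowerSemicontinuous f) (hg : LowerSemicontinuous g) :
    LowerSemicontinuous fun x => f x * g x :=
  lowerSemicontinuous_iff_le_liminf.mpr fun x =>
    (mul_le_mul' (hf.le_liminf x) (hg.le_liminf x)).trans ENNReal.le_liminf_mul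

/-- Fatou's lemma: integrating out one variable preserves lower semicontinuity. -/
theorem lowerSemicontinuous_lintegral {X Y : Type*} [TopologicalSpace X]
    [FirstCountableTopology X] [TopologicalSpace Y] [MeasurableSpace Y] [OpensMeasurableSpace Y]
    (μ : Measure Y) {g : X × Y → ℝ≥0∞} (hg : LowerSemicontinuous g) :
    LowerSemicontinuous fun x => ∫⁻ y, g (x, y) ∂μ := by
  refine lowerSemicontinuous_iff_le_liminf.mpr fun x => ?_
  have h1 : ∀ y, LowerSemicontinuous fun x => g (x, y) := fun y =>
    hg.comp (by fun_prop)
  have h2 : ∀ x, LowerSemicontinuous fun y => g (x, y) := fun x =>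
    hg.comp (by fun_prop)
  exact (lintegral_mono fun y => (h1 y).le_liminf x).trans
    (lintegral_liminf_le fun x => (h2 x).measurable)

/-- The density is strictly positive on `(0,∞)`, so a null set there is Lebesgue null, which a
nonempty open set is not. -/
theorem expMeasure_pos_of_isOpen {r : ℝ} (hr : 0 < r) {V : Set ℝ} (hV : IsOpen V)
    (hne : (V ∩ Ioi 0).Nonempty) : 0 < expMeasure r V := by
  have hW : IsOpen (V ∩ Ioi 0) := hV.inter isOpen_Ioi
  refine lt_of_lt_of_le ?_ (measure_mono (inter_subset_left (t := Ioi 0)))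
  rw [pos_iff_ne_zero]
  intro h0
  change (volume.withDensity (exponentialPDF r)) (V ∩ Ioi 0) = 0 at h0
  rw [withDensity_apply _ hW.measurableSet, setLIntegral_eq_zero_iff hW.measurableSet
    (f := exponentialPDF r) (measurable_exponentialPDFReal r).ennreal_ofReal] at h0
  have hz : volume (V ∩ Ioi 0) = 0 := by
    refine measure_mono_null (fun x hx => ?_) (ae_iff.mp h0)
    simp only [mem_ofPred_eq, Classical.not_imp]
    refine ⟨hx, ?_⟩
    rw [exponentialPDF, ENNReal.ofReal_eq_zero, not_le]
    exact exponentialPDFReal_pos hr hx.2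
  exact (hW.measure_pos volume hne).ne' hz

/-! ### Positivity of means along admissible trajectories -/

namespace System

variable {d : ℕ} {E : Type*} [Fintype E] (S : System d E)

instance : S.waitingLaw.IsOpenPosMeasure := ⟨by
  rintro V hV ⟨u, hu⟩
  rw [waitingLaw, Measure.map_apply (by fun_prop) hV.measurableSet]
  refine (expMeasure_pos_of_isOpen S.lam_pos (hV.preimage continuous_real_toNNReal) ?_).ne'
  -- The point `u` may be `0`; moving slightly to the right gives a strictly positive point of `V`.
  have h : ∀ᶠ v : ℝ≥0 in 𝓝[>] u, v ∈ V ∩ Ioi u :=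
    Filter.inter_mem (mem_nhdsWithin_of_mem_nhds (hV.mem_nhds hu)) self_mem_nhdsWithin
  obtain ⟨v, hv, huv⟩ := h.exists
  exact ⟨v, by simpa using hv, lt_of_le_of_lt u.2 (NNReal.coe_lt_coe.mpr huv)⟩⟩

theorem Phi_zero (i : E) (x : S.M) : S.Phi i 0 x = x :=
  Subtype.ext (isSolution_flow (S.smooth i) (S.bounded.imp fun _ h => h i) (x : Vec d)).1

/-- This is where the strict inequality in `sum_rate_lt` matters: it makes idle jumps possible. -/
theorem Q_self_pos (x : S.M) (i : E) : 0 < S.Q x i i := by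
  classical
  rw [Q, if_pos rfl, ← Finset.sum_div, sub_pos, div_lt_one S.lam_pos,
    Finset.sum_erase _ (S.rate_diag x i)]
  exact S.sum_rate_lt x i

theorem Q_pos_of_rate_pos {x : S.M} {i j : E} (h : 0 < S.rate x i j) : 0 < S.Q x i j := by
  rw [Q, if_neg]
  · exact div_pos h S.lam_pos
  · rintro rfl
    exact h.ne' (S.rate_diag x i)

/-- `h` is lower semicontinuous in elapsed time and position, for each fixed mode. -/
def IsModewiseLSC (h : ℝ≥0 × (S.M × E) → ℝ≥0∞) : Prop :=
  ∀ k, LowerSemicontinuous fun r : ℝ≥0 × S.M => h (r.1, (r.2, k))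

/-- The mean of `h` after one step of the embedded chain, the first coordinate being the time
elapsed so far. -/
noncomputable def timedStep (h : ℝ≥0 × (S.M × E) → ℝ≥0∞) (q : ℝ≥0 × (S.M × E)) : ℝ≥0∞ :=
  ∫⁻ u, ∑ k, ENNReal.ofReal (S.Q (S.Phi q.2.2 u q.2.1) q.2.2 k) *
    h (q.1 + u, (S.Phi q.2.2 u q.2.1, k)) ∂S.waitingLaw

variable {S} {h g : ℝ≥0 × (S.M × E) → ℝ≥0∞}

theorem IsModewiseLSC.integrand (hh : S.IsModewiseLSC h) (i : E) :
    LowerSemicontinuous fun w : (ℝ≥0 × S.M) × ℝ≥0 =>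
      ∑ k, ENNReal.ofReal (S.Q (S.Phi i w.2 w.1.2) i k) *
        h (w.1.1 + w.2, (S.Phi i w.2 w.1.2, k)) := by
  have hΦ : Continuous fun w : (ℝ≥0 × S.M) × ℝ≥0 => S.Phi i w.2 w.1.2 :=
    (S.continuous_Phi i).comp (f := fun w : (ℝ≥0 × S.M) × ℝ≥0 => (w.2, w.1.2)) (by fun_prop)
  refine lowerSemicontinuous_sum fun k _ => lowerSemicontinuous_ennreal_mul ?_ ?_
  · exact (ENNReal.continuous_ofReal.comp ((S.continuous_Q i k).comp hΦ)).lowerSemicontinuous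
  · exact (hh k).comp
      (g := fun w : (ℝ≥0 × S.M) × ℝ≥0 => (w.1.1 + w.2, S.Phi i w.2 w.1.2)) (by fun_prop)

theorem IsModewiseLSC.timedStep (hh : S.IsModewiseLSC h) : S.IsModewiseLSC (S.timedStep h) :=
  fun i => lowerSemicontinuous_lintegral S.waitingLaw (hh.integrand i)

theorem IsModewiseLSC.iterate (hh : S.IsModewiseLSC h) (n : ℕ) :
    S.IsModewiseLSC (S.timedStep^[n] h) := by
  induction n with
  | zero => exact hh
  | succ n ih =>
    rw [Function.iterate_succ_apply']
    exact ih.timedStep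

theorem IsModewiseLSC.measurable_integrand (hh : S.IsModewiseLSC h) (q : ℝ≥0 × (S.M × E)) :
    Measurable fun u => ∑ k, ENNReal.ofReal (S.Q (S.Phi q.2.2 u q.2.1) q.2.2 k) *
      h (q.1 + u, (S.Phi q.2.2 u q.2.1, k)) :=
  ((hh.integrand q.2.2).comp
    (g := fun u : ℝ≥0 => ((q.1, q.2.1), u)) (by fun_prop)).measurable

/-- If `h` is positive at a state that can be reached in one step, then its mean after one step
is positive. -/
theorem IsModewiseLSC.timedStep_pos (hh : S.IsModewiseLSC h) {s u : ℝ≥0} {y : S.M} {i k : E}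
    (hQ : 0 < S.Q (S.Phi i u y) i k) (hpos : 0 < h (s + u, (S.Phi i u y, k))) :
    0 < S.timedStep h (s, (y, i)) := by
  have hl := (hh.integrand i).comp
    (g := fun u : ℝ≥0 => ((s, y), u)) (by fun_prop)
  rw [System.timedStep, lintegral_pos_iff_support (hh.measurable_integrand (s, (y, i)))]
  -- By semicontinuity the integrand is positive on an open set of waiting times, which contains
  -- `u`.
  refine lt_of_lt_of_le (IsOpen.measure_pos S.waitingLaw (hl.isOpen_preimage 0) ⟨u, ?_⟩)
    (measure_mono fun v hv => ?_)
  · rw [mem_preimage, mem_Ioi]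
    refine lt_of_lt_of_le ?_ (Finset.single_le_sum (fun _ _ => zero_le) (Finset.mem_univ k))
    exact ENNReal.mul_pos (ENNReal.ofReal_pos.mpr hQ).ne' hpos.ne'
  · exact ne_of_gt hv

/-- Whether the integral is positive depends on `h` only through its support, the weights `Q` being
the same for both functions. -/
theorem timedStep_support_mono (hh : S.IsModewiseLSC h) (hg : S.IsModewiseLSC g)
    (hgh : ∀ q, 0 < h q → 0 < g q) (q : ℝ≥0 × (S.M × E)) (hq : 0 < S.timedStep h q) :
    0 < S.timedStep g q := by
  rw [System.timedStep, lintegral_pos_iff_support (hg.measurable_integrand q)]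
  rw [System.timedStep, lintegral_pos_iff_support (hh.measurable_integrand q)] at hq
  refine hq.trans_le (measure_mono fun u hu => ?_)
  rw [Function.mem_support, ← pos_iff_ne_zero, Finset.sum_pos_iff] at hu ⊢
  obtain ⟨k, hk, h0⟩ := hu
  exact ⟨k, hk, ENNReal.mul_pos (left_ne_zero_of_mul h0.ne')
    (hgh _ (pos_iff_ne_zero.mpr (right_ne_zero_of_mul h0.ne'))).ne'⟩

/-- The support of the iterates increases if `h` is positive in mean after one step wherever
it is positive. -/
theorem iterate_pos_mono (hh : S.IsModewiseLSC h) (h1 : ∀ q, 0 < h q → 0 < S.timedStep h q)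
    {m n : ℕ} (hmn : m ≤ n) {q : ℝ≥0 × (S.M × E)} (hq : 0 < S.timedStep^[m] h q) :
    0 < S.timedStep^[n] h q := by
  have hs : ∀ n q, 0 < S.timedStep^[n] h q → 0 < S.timedStep^[n + 1] h q := by
    intro n
    induction n with
    | zero => exact h1
    | succ n ih =>
      intro q hq
      rw [Function.iterate_succ_apply'] at hq ⊢
      exact timedStep_support_mono (hh.iterate n) (hh.iterate (n + 1)) ih q hq
  induction n, hmn using Nat.le_induction with
  | base => exact hq
  | succ n _ ih => exact hs n q ih

/-- Irreducibility: positivity in one mode propagates to all modes. -/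
theorem exists_iterate_pos_of_mode (hh : S.IsModewiseLSC h) {s : ℝ≥0} {y : S.M} {k : E}
    (hk : ∃ n, 0 < S.timedStep^[n] h (s, (y, k))) (i : E) :
    ∃ n, 0 < S.timedStep^[n] h (s, (y, i)) := by
  induction S.irreducible y i k using Relation.ReflTransGen.head_induction_on with
  | refl => exact hk
  | @head a b hab _ ih =>
    obtain ⟨n, hn⟩ := ih
    refine ⟨n + 1, ?_⟩
    rw [Function.iterate_succ_apply']
    -- A jump after zero waiting time changes the mode but neither the position nor the elapsed
    -- time.
    refine (hh.iterate n).timedStep_pos (u := 0) (k := b) ?_ ?_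
    · rw [Phi_zero]
      exact S.Q_pos_of_rate_pos hab
    · rwa [Phi_zero, add_zero]

/-- A flow segment is one step of the chain that draws the same mode again. -/
theorem exists_iterate_pos_of_flow (hh : S.IsModewiseLSC h) {s u : ℝ≥0} {y : S.M} {i : E}
    (hk : ∃ n, 0 < S.timedStep^[n] h (s + u, (S.Phi i u y, i))) :
    ∃ n, 0 < S.timedStep^[n] h (s, (y, i)) := by
  obtain ⟨n, hn⟩ := hk
  refine ⟨n + 1, ?_⟩
  rw [Function.iterate_succ_apply']
  exact (hh.iterate n).timedStep_pos (S.Q_self_pos _ i) hn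

/-- If `h` is positive at the end point of a composite flow, then some iterate is positive at the
starting point, in every mode. -/
theorem exists_iterate_pos_of_compositeFlow (hh : S.IsModewiseLSC h) (i : ℕ → E) (u : ℕ → ℝ≥0)
    (x : S.M) (n : ℕ) {j : E}
    (hpos : 0 < h (∑ k ∈ Finset.range n, u (k + 1), (S.compositeFlow i u x n, j))) (a : E) :
    ∃ m, 0 < S.timedStep^[m] h (0, (x, a)) := by
  -- The end mode is left free so that the last segment can be peeled off: irreducibility passes to
  -- mode `i n` at its end point, and the flow of that mode leads back to its starting point.
  have key : ∀ n, (∃ j, ∃ m, 0 < S.timedStep^[m] h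
      (∑ k ∈ Finset.range n, u (k + 1), (S.compositeFlow i u x n, j))) →
      ∀ a, ∃ m, 0 < S.timedStep^[m] h (0, (x, a)) := by
    intro n
    induction n with
    | zero =>
      rintro ⟨j, hj⟩ a
      exact exists_iterate_pos_of_mode hh (by simpa [compositeFlow] using hj) a
    | succ n ih =>
      rintro ⟨j, hj⟩ a
      refine ih ⟨i n, exists_iterate_pos_of_flow hh (u := u (n + 1)) ?_⟩ a
      rw [← Finset.sum_range_succ]
      exact exists_iterate_pos_of_mode hh hj (i n)
  exact key n ⟨j, 0, hpos⟩ a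

end System

end SwitchedFlow

/-! ### Markov property of the chain with its jump times -/

namespace SwitchedFlow.System

variable {d : ℕ} {E : Type*} [Fintype E] {S : System d E}

theorem jumpTime_succ (n : ℕ) (ω : S.Path) :
    S.jumpTime (n + 1) ω = S.jumpTime n ω + (ω (n + 1)).1 :=
  Finset.sum_range_succ _ _

/-- The pair of jump time and state `(T_n, Z̃_n)` as a function of the history up to time `n`. -/
noncomputable def timedState (n : ℕ) (h : (k : Finset.Iic n) → ℝ≥0 × (S.M × E)) :
    ℝ≥0 × (S.M × E) :=
  (∑ k : Finset.range n, (h ⟨k + 1, Finset.mem_Iic.mpr (Finset.mem_range.mp k.2)⟩).1,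
    (h ⟨n, Finset.mem_Iic.mpr le_rfl⟩).2)

theorem timedState_frestrictLe (n : ℕ) (ω : S.Path) :
    timedState n (Preorder.frestrictLe n ω) = (S.jumpTime n ω, S.chain n ω) := by
  simp only [timedState, jumpTime, chain, Preorder.frestrictLe_apply]
  rw [Finset.sum_coe_sort (Finset.range n) (fun k => (ω (k + 1)).1)]

variable [MeasurableSpace E]

theorem measurable_jumpTime (n : ℕ) : Measurable (S.jumpTime n) := by
  unfold jumpTime
  fun_prop

theorem measurable_timedState (n : ℕ) : Measurable (timedState (S := S) n) := by
  unfold timedState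
  fun_prop

variable [MeasurableSingletonClass E]

theorem IsModewiseLSC.measurable {h : ℝ≥0 × (S.M × E) → ℝ≥0∞} (hh : S.IsModewiseLSC h) :
    Measurable h := by
  have h1 : Measurable (fun r : E × (ℝ≥0 × S.M) => h (r.2.1, (r.2.2, r.1))) :=
    measurable_from_prod_countable_right fun k => (hh k).measurable
  exact h1.comp (f := fun q : ℝ≥0 × (S.M × E) => (q.2.2, (q.1, q.2.1))) (by fun_prop)

theorem lintegral_stepKernel (z : S.M × E) {f : ℝ≥0 × (S.M × E) → ℝ≥0∞} (hf : Measurable f) :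
    ∫⁻ w, f w ∂S.stepKernel z = ∫⁻ u, ∑ j, ENNReal.ofReal (S.Q (S.Phi z.2 u z.1) z.2 j) *
      f (u, (S.Phi z.2 u z.1, j)) ∂S.waitingLaw := by
  rw [stepKernel, Kernel.lintegral_comp _ _ _ hf, Kernel.lintegral_id_prod hf.lintegral_kernel,
    Kernel.const_apply]
  refine lintegral_congr fun u => ?_
  change ∫⁻ w, f w ∂S.jumpMeasure (z, u) = _
  simp [jumpMeasure, lintegral_dirac' _ hf]

/-- The rows of `Q` sum to one, so the waiting time has the same law from every state: the clock is
independent of the past. -/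
theorem stepKernel_fst_preimage (z : S.M × E) {A : Set ℝ≥0} (hA : MeasurableSet A) :
    S.stepKernel z (Prod.fst ⁻¹' A) = S.waitingLaw A := by
  rw [stepKernel_apply _ _ (hA.preimage measurable_fst), ← lintegral_indicator_one hA]
  refine lintegral_congr fun u => ?_
  have : ∀ j, (Prod.fst ⁻¹' A).indicator (1 : ℝ≥0 × (S.M × E) → ℝ≥0∞)
      (u, (S.Phi z.2 u z.1, j)) = A.indicator 1 u := fun _ => rfl
  simp only [this]
  rw [← Finset.sum_mul, ← ENNReal.ofReal_sum_of_nonneg fun j _ => S.Q_nonneg _ _ _, S.sum_Q,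
    ENNReal.ofReal_one, one_mul]

/-- The Markov property at a deterministic time: given the history up to time `n`, the next entry
is drawn from `stepKernel`. -/
theorem lintegral_prob_succ (x : S.M) (i : E) (n : ℕ)
    {F : ((k : Finset.Iic n) → ℝ≥0 × (S.M × E)) × (ℝ≥0 × (S.M × E)) → ℝ≥0∞}
    (hF : Measurable F) :
    ∫⁻ ω, F (Preorder.frestrictLe n ω, ω (n + 1)) ∂S.prob x i =
      ∫⁻ ω, ∫⁻ w, F (Preorder.frestrictLe n ω, w) ∂S.stepKernel (S.chain n ω) ∂S.prob x i := by
  have h := Kernel.map_frestrictLe_trajMeasure_compProd_eq_map_trajMeasure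
    (X := fun _ => ℝ≥0 × (S.M × E)) (κ := S.historyKernel)
    (μ₀ := Measure.dirac ((0 : ℝ≥0), (x, i))) (a := n)
  have h' := congrArg (fun ν => ∫⁻ p, F p ∂ν) h
  rw [Measure.lintegral_compProd hF, lintegral_map hF (by fun_prop),
    lintegral_map hF.lintegral_kernel_prod_right' (by fun_prop)] at h'
  exact h'.symm

/-- The indicator of an event of the past is a function of the history, so it passes through the
Markov property. Keeping `A` general serves the repeated trials. -/
theorem setLIntegral_timed_succ (x : S.M) (i : E) {n : ℕ} {A : Set S.Path}
    (hA : MeasurableSet[Filtration.piLE (X := fun _ => ℝ≥0 × (S.M × E)) n] A)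
    {f : ℝ≥0 × (S.M × E) → ℝ≥0∞} (hf : Measurable f) :
    ∫⁻ ω in A, f (S.jumpTime (n + 1) ω, S.chain (n + 1) ω) ∂S.prob x i =
      ∫⁻ ω in A, S.timedStep f (S.jumpTime n ω, S.chain n ω) ∂S.prob x i := by
  have hA' := Filtration.piLE.le n A hA
  rw [Filtration.piLE_eq_comap_frestrictLe] at hA
  obtain ⟨B, hB, rfl⟩ := hA
  have hτ := measurable_timedState (S := S) n
  have hF : Measurable fun p : ((k : Finset.Iic n) → ℝ≥0 × (S.M × E)) × (ℝ≥0 × (S.M × E)) =>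
      B.indicator 1 p.1 * f ((timedState n p.1).1 + p.2.1, p.2.2) :=
    ((measurable_one.indicator hB).comp measurable_fst).mul (hf.comp (by fun_prop))
  have h := lintegral_prob_succ x i n hF
  rw [← lintegral_indicator hA', ← lintegral_indicator hA']
  have hind : ∀ (g : S.Path → ℝ≥0∞) (ω : S.Path),
      (Preorder.frestrictLe n ⁻¹' B).indicator g ω =
        B.indicator 1 (Preorder.frestrictLe n ω) * g ω := by
    intro g ω
    by_cases hω : Preorder.frestrictLe n ω ∈ B
    · simp [indicator, hω]
    · simp [indicator, hω]
  simp only [hind]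
  simp only [timedState_frestrictLe] at h
  simp only [jumpTime_succ]
  refine h.trans (lintegral_congr fun ω => ?_)
  have hm : Measurable fun w : ℝ≥0 × (S.M × E) => f (S.jumpTime n ω + w.1, w.2) :=
    hf.comp (by fun_prop)
  rw [lintegral_const_mul _ hm, lintegral_stepKernel _ hm]
  rfl

theorem setLIntegral_timed_add (x : S.M) (i : E) {n : ℕ} {A : Set S.Path}
    (hA : MeasurableSet[Filtration.piLE (X := fun _ => ℝ≥0 × (S.M × E)) n] A)
    {f : ℝ≥0 × (S.M × E) → ℝ≥0∞} (hf : S.IsModewiseLSC f) (m : ℕ) :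
    ∫⁻ ω in A, f (S.jumpTime (n + m) ω, S.chain (n + m) ω) ∂S.prob x i =
      ∫⁻ ω in A, S.timedStep^[m] f (S.jumpTime n ω, S.chain n ω) ∂S.prob x i := by
  induction m generalizing f with
  | zero => rfl
  | succ m ih =>
    rw [Function.iterate_succ_apply, ← ih hf.timedStep, ← add_assoc,
      setLIntegral_timed_succ x i (Filtration.piLE.mono (Nat.le_add_right n m) _ hA)
        hf.measurable]

theorem prob_chain_zero (x : S.M) (i : E) : ∀ᵐ ω ∂S.prob x i, S.chain 0 ω = (x, i) := by
  have h : (S.prob x i).map (Preorder.frestrictLe 0) =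
      Measure.dirac ((MeasurableEquiv.piUnique
        (fun _ : Finset.Iic 0 => ℝ≥0 × (S.M × E))).symm (0, (x, i))) := by
    rw [prob, Kernel.trajMeasure, Measure.map_comp _ _ (by fun_prop),
      Kernel.traj_map_frestrictLe, Kernel.partialTraj_self, Measure.id_comp]
    exact Measure.map_dirac' (MeasurableEquiv.measurable _) _
  have hm : Measurable fun p : (k : Finset.Iic 0) → ℝ≥0 × (S.M × E) =>
      (p ⟨0, Finset.mem_Iic.mpr le_rfl⟩).2 := by fun_prop
  have hs : MeasurableSet {p : (k : Finset.Iic 0) → ℝ≥0 × (S.M × E) |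
      (p ⟨0, Finset.mem_Iic.mpr le_rfl⟩).2 = (x, i)} := hm (measurableSet_singleton (x, i))
  have h2 : ∀ᵐ p ∂(S.prob x i).map (Preorder.frestrictLe 0),
      (p ⟨0, Finset.mem_Iic.mpr le_rfl⟩).2 = (x, i) := by
    rw [h, ae_dirac_iff hs]
    rfl
  exact ae_of_ae_map (by fun_prop) h2

/-- The law of `(T_m, Z̃_m)` under `P_{x,i}`. -/
theorem lintegral_timed (x : S.M) (i : E)
    {f : ℝ≥0 × (S.M × E) → ℝ≥0∞} (hf : S.IsModewiseLSC f) (m : ℕ) :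
    ∫⁻ ω, f (S.jumpTime m ω, S.chain m ω) ∂S.prob x i = S.timedStep^[m] f (0, (x, i)) := by
  have h := setLIntegral_timed_add x i (n := 0) (A := univ) MeasurableSet.univ hf m
  rw [Measure.restrict_univ, Nat.zero_add] at h
  rw [h]
  have : ∀ᵐ ω ∂S.prob x i, S.timedStep^[m] f (S.jumpTime 0 ω, S.chain 0 ω) =
      S.timedStep^[m] f (0, (x, i)) := by
    filter_upwards [prob_chain_zero x i] with ω hω
    rw [hω]
    rfl
  rw [lintegral_congr_ae this, lintegral_const, measure_univ, mul_one]

end SwitchedFlow.System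

/-! ### Uniform lower bounds by compactness -/

namespace SwitchedFlow

theorem exists_pos_le_of_finite {ι : Type*} [Finite ι] {f : ι → ℝ≥0∞} (hf : ∀ a, 0 < f a) :
    ∃ ε, 0 < ε ∧ ∀ a, ε ≤ f a := by
  cases nonempty_fintype ι
  exact ⟨Finset.univ.inf f, (Finset.lt_inf_iff ENNReal.zero_lt_top).mpr fun a _ => hf a,
    fun a => Finset.inf_le (Finset.mem_univ a)⟩

namespace System

variable {d : ℕ} {E : Type*} [Fintype E] {S : System d E}

theorem isModewiseLSC_indicator {G : Set (ℝ≥0 × (S.M × E))}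
    (hG : ∀ k, IsOpen {r : ℝ≥0 × S.M | (r.1, (r.2, k)) ∈ G}) :
    S.IsModewiseLSC (G.indicator 1) :=
  fun k => (hG k).lowerSemicontinuous_indicator (y := (1 : ℝ≥0∞)) zero_le

theorem isOpen_mode_slice {V : Set S.M} (hV : IsOpen V) (j k : E) :
    IsOpen {r : ℝ≥0 × S.M | (r.1, (r.2, k)) ∈ Prod.snd ⁻¹' (V ×ˢ {j})} := by
  by_cases h : k = j
  · have : IsOpen {r : ℝ≥0 × S.M | r.2 ∈ V} := hV.preimage continuous_snd
    simpa [h] using this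
  · simp [h]

/-- Homogeneity in time: a bound proved at elapsed time `0` can be used when restarting from `(T_n,
Z̃_n)`. -/
theorem iterate_eq_of_time_independent {h : ℝ≥0 × (S.M × E) → ℝ≥0∞}
    (hh : ∀ s s' z, h (s, z) = h (s', z)) (m : ℕ) (s s' : ℝ≥0) (z : S.M × E) :
    S.timedStep^[m] h (s, z) = S.timedStep^[m] h (s', z) := by
  induction m generalizing s s' z with
  | zero => exact hh s s' z
  | succ m ih =>
    simp only [Function.iterate_succ_apply', timedStep]
    exact lintegral_congr fun u => Finset.sum_congr rfl fun k _ => by rw [ih (s + u) (s' + u)]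

theorem exists_compositeFlow_mem {p : S.M} (hp : p ∈ S.accessibleSet) {V : Set S.M}
    (hV : IsOpen V) (hpV : p ∈ V) (x : S.M) :
    ∃ (n : ℕ) (i : ℕ → E) (u : ℕ → ℝ≥0), S.compositeFlow i u x n ∈ V := by
  obtain ⟨y, hy, n, _, i, u, rfl⟩ := mem_closure_iff.mp (mem_iInter.mp hp x) V hV hpV
  exact ⟨n, i, u, hy⟩

/-- For fixed modes, the starting points with positive `n`-th mean form open sets that increase with
`n` (idle jumps) and cover `M` (accessibility), so one of them is all of `M`. The largest `n` over
the finitely many pairs of modes then serves them all. -/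
theorem exists_forall_iterate_pos {p : S.M} (hp : p ∈ S.accessibleSet) {V : Set S.M}
    (hV : IsOpen V) (hpV : p ∈ V) :
    ∃ m : ℕ, ∀ (i j : E) (x : S.M),
      0 < S.timedStep^[m] ((Prod.snd ⁻¹' (V ×ˢ {j})).indicator 1) (0, (x, i)) := by
  have hcpt : CompactSpace S.M := isCompact_iff_compactSpace.mp S.isCompact
  have hlsc := fun j => isModewiseLSC_indicator (isOpen_mode_slice (S := S) hV j)
  have hstep : ∀ j q, 0 < (Prod.snd ⁻¹' (V ×ˢ {j})).indicator (1 : ℝ≥0 × (S.M × E) → ℝ≥0∞) q →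
      0 < S.timedStep ((Prod.snd ⁻¹' (V ×ˢ {j})).indicator 1) q := by
    rintro j ⟨s, y, i⟩ hq
    refine (hlsc j).timedStep_pos (u := 0) (k := i) (S.Q_self_pos _ i) ?_
    rwa [Phi_zero, add_zero]
  have hN : ∀ a : E × E, ∃ n, ∀ x,
      0 < S.timedStep^[n] ((Prod.snd ⁻¹' (V ×ˢ {a.2})).indicator 1) (0, (x, a.1)) := by
    rintro ⟨i, j⟩
    have hmono : Monotone fun n => {x | 0 < S.timedStep^[n]
        ((Prod.snd ⁻¹' (V ×ˢ {j})).indicator 1) (0, (x, i))} := fun a b hab x hx =>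
      iterate_pos_mono (hlsc j) (hstep j) hab hx
    obtain ⟨n, hn⟩ := isCompact_univ.elim_directed_cover _ (fun n =>
      (((hlsc j).iterate n i).comp (g := fun x : S.M => ((0 : ℝ≥0), x))
        (by fun_prop)).isOpen_preimage 0) (fun x _ => by
          obtain ⟨n, a, u, hn⟩ := exists_compositeFlow_mem hp hV hpV x
          exact mem_iUnion.mpr (exists_iterate_pos_of_compositeFlow (hlsc j) a u x n
            (j := j) (by simp [hn]) i)) hmono.directed_le
    exact ⟨n, fun x => hn (mem_univ x)⟩
  choose N hN using hN
  exact ⟨Finset.univ.sup N, fun i j x => iterate_pos_mono (hlsc j) (hstep j)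
    (Finset.le_sup (Finset.mem_univ (i, j))) (hN (i, j) x)⟩

theorem exists_forall_le_iterate {p : S.M} (hp : p ∈ S.accessibleSet) {V : Set S.M}
    (hV : IsOpen V) (hpV : p ∈ V) :
    ∃ (m : ℕ) (ε : ℝ≥0∞), 0 < ε ∧ ∀ (j : E) (q : ℝ≥0 × (S.M × E)),
      ε ≤ S.timedStep^[m] ((Prod.snd ⁻¹' (V ×ˢ {j})).indicator 1) q := by
  have hcpt : CompactSpace S.M := isCompact_iff_compactSpace.mp S.isCompact
  obtain ⟨m, hm⟩ := exists_forall_iterate_pos hp hV hpV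
  have hmin : ∀ a : E × E, ∃ y, ∀ x,
      S.timedStep^[m] ((Prod.snd ⁻¹' (V ×ˢ {a.2})).indicator 1) (0, (y, a.1)) ≤
      S.timedStep^[m] ((Prod.snd ⁻¹' (V ×ˢ {a.2})).indicator 1) (0, (x, a.1)) := by
    intro a
    have hl := ((isModewiseLSC_indicator (isOpen_mode_slice (S := S) hV a.2)).iterate m a.1).comp
      (g := fun x : S.M => ((0 : ℝ≥0), x)) (by fun_prop)
    obtain ⟨y, _, hy⟩ :=
      (hl.lowerSemicontinuousOn univ).exists_isMinOn ⟨p, mem_univ p⟩ isCompact_univ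
    exact ⟨y, fun x => hy (mem_univ x)⟩
  choose y hy using hmin
  obtain ⟨ε, hε, hle⟩ := exists_pos_le_of_finite fun a : E × E => hm a.1 a.2 (y a)
  refine ⟨m, ε, hε, fun j q => ?_⟩
  rw [iterate_eq_of_time_independent (fun s s' z => rfl) m q.1 0 q.2]
  exact (hle (q.2.2, j)).trans (hy (q.2.2, j) q.2.1)

variable (S) in
/-- The states `(s, (y, k))` with `s < t` from which the flow of mode `k = j` leads into `V` at
time `t`. -/
def flowInto (t : ℝ≥0) (V : Set S.M) (j : E) : Set (ℝ≥0 × (S.M × E)) :=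
  {q | q.1 < t ∧ S.Phi q.2.2 (t - q.1) q.2.1 ∈ V ∧ q.2.2 = j}

theorem isModewiseLSC_flowInto (t : ℝ≥0) {V : Set S.M} (hV : IsOpen V) (j : E) :
    S.IsModewiseLSC ((S.flowInto t V j).indicator 1) := by
  refine isModewiseLSC_indicator fun k => ?_
  by_cases h : k = j
  -- Truncated subtraction on `ℝ≥0` is continuous; the strict inequality `s < t` keeps the set open.
  · have hc : Continuous fun r : ℝ≥0 × S.M => S.Phi k (t - r.1) r.2 :=
      (S.continuous_Phi k).comp (f := fun r : ℝ≥0 × S.M => (t - r.1, r.2)) (by fun_prop)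
    have ho : IsOpen {r : ℝ≥0 × S.M | r.1 < t ∧ S.Phi k (t - r.1) r.2 ∈ V} :=
      (isOpen_lt continuous_fst continuous_const).inter (hV.preimage hc)
    simpa [flowInto, h] using ho
  · simp [flowInto, h]

/-! ### Almost sure hitting and the process at a fixed time -/

variable [MeasurableSpace E]

theorem measurable_chain (n : ℕ) : Measurable (S.chain n) := by
  unfold chain
  fun_prop

variable [MeasurableSingletonClass E]

theorem mul_le_prob_inter_chain {V : Set S.M} (hV : IsOpen V) {j : E} {m : ℕ} {ε : ℝ≥0∞}
    (hε : ∀ q, ε ≤ S.timedStep^[m] ((Prod.snd ⁻¹' (V ×ˢ {j})).indicator 1) q)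
    (x : S.M) (i : E) {n : ℕ} {A : Set S.Path}
    (hA : MeasurableSet[Filtration.piLE (X := fun _ => ℝ≥0 × (S.M × E)) n] A) :
    ε * S.prob x i A ≤ S.prob x i (A ∩ S.chain (n + m) ⁻¹' (V ×ˢ {j})) := by
  have hT : MeasurableSet (V ×ˢ {j} : Set (S.M × E)) :=
    hV.measurableSet.prod (measurableSet_singleton j)
  calc ε * S.prob x i A
      = ∫⁻ _ in A, ε ∂S.prob x i := by rw [setLIntegral_const]
    _ ≤ ∫⁻ ω in A, S.timedStep^[m] ((Prod.snd ⁻¹' (V ×ˢ {j})).indicator 1)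
          (S.jumpTime n ω, S.chain n ω) ∂S.prob x i := lintegral_mono fun ω => hε _
    _ = ∫⁻ ω in A, (S.chain (n + m) ⁻¹' (V ×ˢ {j})).indicator 1 ω ∂S.prob x i :=
        (setLIntegral_timed_add x i hA (isModewiseLSC_indicator (isOpen_mode_slice hV j)) m).symm
    _ = S.prob x i (A ∩ S.chain (n + m) ⁻¹' (V ×ˢ {j})) := by
        rw [lintegral_indicator_one (measurable_chain _ hT),
          Measure.restrict_apply (measurable_chain _ hT), inter_comm]

/-- Every block of `m` steps ends in the target with conditional probability at least `ε`, whatever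
the past, so missing it at the times `0, m, …, mK` has probability at most `(1 - ε)^K`. -/
theorem ae_exists_chain_mem {V : Set S.M} (hV : IsOpen V) {j : E} {m : ℕ} {ε : ℝ≥0∞}
    (h0 : 0 < ε)
    (hε : ∀ q, ε ≤ S.timedStep^[m] ((Prod.snd ⁻¹' (V ×ˢ {j})).indicator 1) q)
    (x : S.M) (i : E) : ∀ᵐ ω ∂S.prob x i, ∃ l, S.chain l ω ∈ V ×ˢ {j} := by
  have hT : MeasurableSet (V ×ˢ {j} : Set (S.M × E)) :=
    hV.measurableSet.prod (measurableSet_singleton j)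
  let A : ℕ → Set S.Path := fun K => {ω | ∀ k ≤ K, S.chain (m * k) ω ∉ V ×ˢ {j}}
  have hA : ∀ K, MeasurableSet[Filtration.piLE (X := fun _ => ℝ≥0 × (S.M × E)) (m * K)]
      (A K) := by
    intro K
    rw [Filtration.piLE_eq_comap_frestrictLe]
    refine ⟨{h | ∀ (k : ℕ) (hk : k ≤ K),
      (h ⟨m * k, Finset.mem_Iic.mpr (Nat.mul_le_mul_left m hk)⟩).2 ∉ V ×ˢ {j}}, ?_, rfl⟩
    simp only [ofPred_forall]
    refine MeasurableSet.iInter fun k => MeasurableSet.iInter fun hk => ?_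
    exact (measurable_snd.comp (measurable_pi_apply _)) hT.compl
  have hstep : ∀ K, S.prob x i (A (K + 1)) ≤ (1 - ε) * S.prob x i (A K) := by
    intro K
    have h1 := mul_le_prob_inter_chain hV hε x i (hA K)
    have h2 := measure_inter_add_sdiff (μ := S.prob x i) (A K)
      (measurable_chain (m * K + m) hT)
    have h3 : A (K + 1) ⊆ A K \ S.chain (m * K + m) ⁻¹' (V ×ˢ {j}) := fun ω hω =>
      ⟨fun k hk => hω k (hk.trans K.le_succ), hω (K + 1) le_rfl⟩
    rw [ENNReal.sub_mul (fun _ _ => measure_ne_top _ _), one_mul]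
    refine ENNReal.le_sub_of_add_le_left ?_ ?_
    · exact ne_top_of_le_ne_top (measure_ne_top _ _) h1
    · exact (add_le_add h1 (measure_mono h3)).trans h2.le
  have hpow : ∀ K, S.prob x i (A K) ≤ (1 - ε) ^ K := by
    intro K
    induction K with
    | zero => simpa using prob_le_one
    | succ K ih => exact (hstep K).trans (by rw [pow_succ']; gcongr)
  have hlim := ENNReal.tendsto_pow_atTop_nhds_zero_of_lt_one
    (ENNReal.sub_lt_self ENNReal.one_ne_top one_ne_zero h0.ne')
  rw [ae_iff]
  refine le_antisymm (ge_of_tendsto' hlim fun K => (measure_mono ?_).trans (hpow K)) zero_le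
  intro ω hω k _ hk
  exact hω ⟨_, hk⟩

/-- If `(T_n, Z̃_n)` lies in `flowInto t V j` and `U_{n+1} > t`, then `Z_t ∈ V × {j}`. -/
theorem mul_le_prob_process (t : ℝ≥0) {V : Set S.M} (hV : IsOpen V) (j : E) (n : ℕ) (x : S.M)
    (i : E) :
    S.timedStep^[n] ((S.flowInto t V j).indicator 1) (0, (x, i)) * S.waitingLaw (Ioi t) ≤
      S.prob x i {ω | S.process t ω ∈ V ×ˢ {j}} := by
  have hl := isModewiseLSC_flowInto (S := S) t hV j
  have hi : Measurable ((Ioi t).indicator (1 : ℝ≥0 → ℝ≥0∞)) :=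
    measurable_one.indicator measurableSet_Ioi
  -- The condition `U_{n+1} > t` is stronger than the needed `T_{n+1} > t`, but it is independent of
  -- the history, so the probability factorises.
  have hF : Measurable fun w : ((k : Finset.Iic n) → ℝ≥0 × (S.M × E)) × (ℝ≥0 × (S.M × E)) =>
      (S.flowInto t V j).indicator (1 : ℝ≥0 × (S.M × E) → ℝ≥0∞) (timedState n w.1) *
        (Ioi t).indicator 1 w.2.1 :=
    (hl.measurable.comp ((measurable_timedState n).comp measurable_fst)).mul
      (hi.comp (by fun_prop))
  have h := lintegral_prob_succ x i n hF
  simp only [timedState_frestrictLe] at h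
  have hw : ∀ (c : ℝ≥0∞) (z : S.M × E),
      ∫⁻ w, c * (Ioi t).indicator (1 : ℝ≥0 → ℝ≥0∞) w.1 ∂S.stepKernel z =
        c * S.waitingLaw (Ioi t) := fun c z => by
    have hi' : Measurable fun w : ℝ≥0 × (S.M × E) =>
        (Ioi t).indicator (1 : ℝ≥0 → ℝ≥0∞) w.1 := hi.comp measurable_fst
    rw [lintegral_const_mul _ hi', ← stepKernel_fst_preimage z
      measurableSet_Ioi, ← lintegral_indicator_one (measurable_fst measurableSet_Ioi)]
    rfl
  simp only [hw] at h
  have hG : Measurable fun ω : S.Path =>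
      (S.flowInto t V j).indicator (1 : ℝ≥0 × (S.M × E) → ℝ≥0∞) (S.jumpTime n ω, S.chain n ω) :=
    hl.measurable.comp ((measurable_jumpTime n).prodMk (measurable_chain n))
  rw [lintegral_mul_const _ hG, lintegral_timed x i hl n] at h
  rw [← h]
  refine le_trans (lintegral_mono fun ω => ?_) (lintegral_indicator_one_le _)
  by_cases h1 : (S.jumpTime n ω, S.chain n ω) ∈ S.flowInto t V j
  · by_cases h2 : t < (ω (n + 1)).1
    · obtain ⟨hlt, hmem, hj⟩ := id h1
      have hω : ω ∈ {ω | S.process t ω ∈ V ×ˢ {j}} := by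
        rw [mem_ofPred_eq, S.process_eq hlt.le
          (by rw [jumpTime_succ]; exact h2.trans_le le_add_self)]
        exact ⟨hmem, hj⟩
      rw [indicator_of_mem hω, indicator_of_mem h1, indicator_of_mem (mem_Ioi.mpr h2)]
      simp
    · simp [h2]
  · simp [h1]

/-- For every starting point there is a time `t > 0` such that, from nearby points and from all
modes, the process is in `V × {j}` at time `t` with probability bounded below. -/
theorem exists_nhds_le_prob_process {p : S.M} (hp : p ∈ S.accessibleSet) {V : Set S.M}
    (hV : IsOpen V) (hpV : p ∈ V) (x : S.M) :
    ∃ (O : Set S.M) (t : ℝ≥0) (ε : ℝ≥0∞), IsOpen O ∧ x ∈ O ∧ 0 < t ∧ 0 < ε ∧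
      ∀ (i j : E), ∀ y ∈ O, ε ≤ S.prob y i {ω | S.process t ω ∈ V ×ˢ {j}} := by
  obtain ⟨n, a, u, hn⟩ := exists_compositeFlow_mem hp hV hpV x
  -- The extra time `η` makes the last jump occur strictly before `t` and makes `t` positive; it is
  -- small enough that no mode leaves `V` meanwhile.
  obtain ⟨η, hηV, hη⟩ : ∃ η : ℝ≥0, (∀ k, S.Phi k η (S.compositeFlow a u x n) ∈ V) ∧ 0 < η := by
    have h : ∀ᶠ η : ℝ≥0 in 𝓝[>] 0, ∀ k, S.Phi k η (S.compositeFlow a u x n) ∈ V := by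
      rw [Filter.eventually_all]
      intro k
      have hc : Continuous fun η : ℝ≥0 => S.Phi k η (S.compositeFlow a u x n) :=
        (S.continuous_Phi k).comp
          (f := fun η : ℝ≥0 => (η, S.compositeFlow a u x n)) (by fun_prop)
      exact mem_nhdsWithin_of_mem_nhds
        ((hV.preimage hc).mem_nhds (by rwa [mem_preimage, Phi_zero]))
    exact (h.and self_mem_nhdsWithin).exists
  let t := ∑ k ∈ Finset.range n, u (k + 1) + η
  have hm : ∀ b : E × E, ∃ m,
      0 < S.timedStep^[m] ((S.flowInto t V b.2).indicator 1) (0, (x, b.1)) := fun b => by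
    refine exists_iterate_pos_of_compositeFlow (isModewiseLSC_flowInto t hV b.2) a u x n
      (j := b.2) ?_ b.1
    rw [indicator_of_mem]
    · exact one_pos
    · exact ⟨lt_add_of_pos_right _ hη, by simpa [t] using hηV b.2, rfl⟩
  -- The number of jumps may depend on the pair of modes, since only `t` enters the final event.
  choose m hm using hm
  obtain ⟨ε, hε, hle⟩ := exists_pos_le_of_finite hm
  -- A strictly smaller bound gives superlevel sets that are open and contain `x`.
  obtain ⟨ε', hε', hlt⟩ := exists_between hε
  refine ⟨⋂ b : E × E, {y | ε' < S.timedStep^[m b] ((S.flowInto t V b.2).indicator 1)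
    (0, (y, b.1))}, t, ε' * S.waitingLaw (Ioi t), ?_, ?_, ?_, ?_, ?_⟩
  · exact isOpen_iInter_of_finite fun b =>
      (((isModewiseLSC_flowInto t hV b.2).iterate (m b) b.1).comp
        (g := fun x : S.M => ((0 : ℝ≥0), x)) (by fun_prop)).isOpen_preimage ε'
  · exact mem_iInter.mpr fun b => hlt.trans_le (hle b)
  · exact hη.trans_le le_add_self
  · exact ENNReal.mul_pos hε'.ne' (isOpen_Ioi.measure_pos _ nonempty_Ioi).ne'
  · intro i j y hy
    exact (mul_le_mul_left (mem_iInter.mp hy (i, j)).le _).trans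
      (mul_le_prob_process t hV j (m (i, j)) y i)

end System

/-- Truncation at `1` covers `ε = ∞`, the infimum over an empty family, which `toReal` would send to
`0`. -/
theorem toReal_min_one_pos {ε : ℝ≥0∞} (hε : 0 < ε) : 0 < (min ε 1).toReal :=
  ENNReal.toReal_pos (lt_min hε one_pos).ne' (min_lt_of_right_lt ENNReal.one_lt_top).ne

theorem toReal_min_one_le_real {Ω : Type*} [MeasurableSpace Ω] {μ : Measure Ω}
    [IsFiniteMeasure μ] {A : Set Ω} {ε : ℝ≥0∞} (h : ε ≤ μ A) : (min ε 1).toReal ≤ μ.real A :=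
  ENNReal.toReal_mono (measure_ne_top _ _) ((min_le_left _ _).trans h)

end SwitchedFlow

theorem mainTheorem10 {d : ℕ} {E : Type*} [Fintype E] [MeasurableSpace E]
    [MeasurableSingletonClass E] (S : SwitchedFlow.System d E)
    (p : S.M) (hp : p ∈ S.accessibleSet) (U : Set S.M) (hU : U ∈ 𝓝 p) :
    (∃ (m : ℕ) (δ : ℝ), 0 < δ ∧ ∀ (x : S.M) (i j : E),
      δ ≤ (S.prob x i).real {ω | S.chain m ω ∈ U ×ˢ {j}}) ∧
    (∀ (x : S.M) (i j : E), ∀ᵐ ω ∂(S.prob x i), ∃ l : ℕ, S.chain l ω ∈ U ×ˢ {j}) ∧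
    (∃ (N : ℕ) (O : Fin N → Set S.M) (t : Fin N → ℝ≥0) (δ : ℝ),
      (∀ k, IsOpen (O k)) ∧ (⋃ k, O k) = univ ∧ (∀ k, 0 < t k) ∧ 0 < δ ∧
      ∀ (i j : E) (k : Fin N), ∀ x ∈ O k,
        δ ≤ (S.prob x i).real {ω | S.process (t k) ω ∈ U ×ˢ {j}}) := by
  obtain ⟨V, hVU, hV, hpV⟩ := mem_nhds_iff.mp hU
  have hsub : ∀ j : E, V ×ˢ {j} ⊆ U ×ˢ {j} := fun j => prod_mono_left hVU
  obtain ⟨m, ε, hε, hle⟩ := SwitchedFlow.System.exists_forall_le_iterate hp hV hpV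
  refine ⟨⟨m, _, SwitchedFlow.toReal_min_one_pos hε, fun x i j => ?_⟩, fun x i j => ?_, ?_⟩
  · refine SwitchedFlow.toReal_min_one_le_real ?_
    have h := SwitchedFlow.System.mul_le_prob_inter_chain hV (hle j) x i (n := 0) (A := univ)
      MeasurableSet.univ
    rw [measure_univ, mul_one, univ_inter, Nat.zero_add] at h
    exact h.trans (measure_mono fun ω hω => hsub j hω)
  · filter_upwards [SwitchedFlow.System.ae_exists_chain_mem hV hε (hle j) x i] with ω hω
    exact hω.imp fun l hl => hsub j hl
  · have hcpt : CompactSpace S.M := isCompact_iff_compactSpace.mp S.isCompact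
    -- Each point has its own neighbourhood, time and bound; compactness keeps finitely many, and
    -- the smallest bound gives `δ`.
    choose O t c hO hxO ht hc hcle using
      SwitchedFlow.System.exists_nhds_le_prob_process hp hV hpV
    obtain ⟨s, hs⟩ := isCompact_univ.elim_finite_subcover O hO
      fun x _ => mem_iUnion.mpr ⟨x, hxO x⟩
    obtain ⟨δ, hδ, hδle⟩ := SwitchedFlow.exists_pos_le_of_finite fun k : s => hc k
    refine ⟨s.card, fun k => O (s.equivFin.symm k), fun k => t (s.equivFin.symm k), _,
      fun k => hO _, ?_, fun k => ht _, SwitchedFlow.toReal_min_one_pos hδ,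
      fun i j k x hx => SwitchedFlow.toReal_min_one_le_real ?_⟩
    · refine eq_univ_of_forall fun x => ?_
      obtain ⟨y, hy, hxy⟩ := mem_iUnion₂.mp (hs (mem_univ x))
      exact mem_iUnion.mpr ⟨s.equivFin ⟨y, hy⟩, by simpa using hxy⟩
    · exact ((hδle _).trans (hcle _ i j x hx)).trans (measure_mono fun ω hω => hsub j hω)
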